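/- Let $\mathcal H$ be a real Hilbert space, $N\ge 1$, $\mathcal Q\subset\mathcal H$ nonempty, closed and convex, and let $f_1,\dots,f_N\colon\mathcal H\to\mathbb R$ be convex and lower semicontinuous. Let $\beta>0$ and let $h\colon\mathcal H\to\mathbb R$ be convex and differentiable with $\beta^{-1}$-Lipschitz gradient. Put $\mathcal P_1=\{p\in\mathbb R^N:\sum_{i=1}^N p_i=1\}$, let $e_1,\dots,e_N$ be the canonical basis of $\mathbb R^N$, and write $\partial$ for the convex subdifferential, $N_S$ for the normal cone of a convex set $S$ (with $N_S(x)=\emptyset$ if $x\notin S$), $\operatorname{proj}_S$ for the projection and $J_A=(\mathrm{Id}+A)^{-1}$ for the resolvent. For $(x,p)\in\mathcal H\times\mathbb R^N$ define $$B_i(x,p)=\begin{pmatrix}p_i\,\partial f_i(x)\\ N_{[0,+\infty[}(p_i)\,e_i-f_i(x)e_i\end{pmatrix}\ (1\le i\le N),\quad A_1(x,p)=\begin{pmatrix}N_{\mathcal Q}(x)\\ N_{\mathcal P_1}(p)\end{pmatrix},\quad C(x,p)=\begin{pmatrix}\nabla h(x)\\ 0\end{pmatrix}.$$ Consider the inclusion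 $$\text{(I)}\qquad 0\in A_1(x,p)+\sum_{i=1}^N B_i(x,p)+C(x,p),\qquad (x,p)\in\mathcal H\times\mathbb R^N,$$ and its reformulation on the Hilbert space $\mathsf H_1=(\mathcal H\times\mathbb R^N)^{N+1}$ $$\text{(II)}\qquad 0\in \widetilde A_1(z)+\widetilde C_1(z)+N_{V_1}(z),\qquad z\in\mathsf H_1,$$ where $\widetilde A_1=B_1\times\cdots\times B_N\times A_1$, $\widetilde C_1(z)=(C(z_1),0,\dots,0)$ and $V_1=\{z\in\mathsf H_1: z_1=\cdots=z_{N+1}\}$. Assume that (I) has at least one solution. Let $\gamma\in\,]0,2\beta[$. Then every resolvent $J_{\gamma B_i}$ is single-valued and defined everywhere. Let $z^0=((x_i^0,p_i^0))_{i=1}^{N+1}\in V_1$ and $\bar z^0=((\bar x_i^0,\bar p_i^0))_{i=1}^{N+1}\in V_1^\perp$, and define, for every $k\in\mathbb N$, $$\begin{aligned} (\tilde x_i^k,\tilde p_i^k)&=J_{\gamma B_i}\Big(x_i^k+\gamma\bar x_i^k-\tfrac{\gamma}{N+1}\nabla h(x_1^k),\ p_i^k+\gamma\bar p_i^k\Big),\quad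 1\le i\le N,\\ (\tilde x_{N+1}^k,\tilde p_{N+1}^k)&=\Big(\operatorname{proj}_{\mathcal Q}\big(x_{N+1}^k+\gamma\bar x_{N+1}^k-\tfrac{\gamma}{N+1}\nabla h(x_1^k)\big),\ \operatorname{proj}_{\mathcal P_1}\big(p_{N+1}^k+\gamma\bar p_{N+1}^k\big)\Big),\\ z_i^{k+1}=(x_i^{k+1},p_i^{k+1})&=\tfrac1{N+1}\sum_{j=1}^{N+1}(\tilde x_j^k,\tilde p_j^k),\quad 1\le i\le N+1,\\ \bar z_i^{k+1}=(\bar x_i^{k+1},\bar p_i^{k+1})&=(\bar x_i^k,\bar p_i^k)+\tfrac1\gamma\,(x_i^{k+1}-\tilde x_i^k,\ p_i^{k+1}-\tilde p_i^k),\quad 1\le i\le N+1. \end{aligned}$$ Then there exists a solution $z\in V_1$ of (II) such that $z^k\rightharpoonup z$ weakly in $\mathsf H_1$; moreover, the common block $(x,p)=z_1=\cdots=z_{N+1}$ is a solution of (I). -/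

import Mathlib

open scoped Pointwise

noncomputable section

namespace FBSub

/-! ### Convex analysis -/

section ConvexAnalysis

variable {E : Type*} [NormedAddCommGroup E] [InnerProductSpace ℝ E]

/-- The normal cone `N_S(x)`; it is empty when `x ∉ S`. -/
def normalCone (S : Set E) (x : E) : Set E :=
  {u | x ∈ S ∧ ∀ y ∈ S, inner ℝ u (y - x) ≤ 0}

/-- The convex subdifferential `∂f(x)` of an everywhere finite function `f`. -/
def subdiff (f : E → ℝ) (x : E) : Set E :=
  {u | ∀ y, f x + inner ℝ u (y - x) ≤ f y}

/-- `IsProj S x y` : `y` minimizes the distance to `x` over `S`. -/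
def IsProj (S : Set E) (x y : E) : Prop :=
  y ∈ S ∧ ∀ w ∈ S, ‖x - y‖ ≤ ‖x - w‖

/-- The projection onto `S`. For `S` nonempty, closed and convex in a Hilbert space, it is the
unique `y` with `IsProj S x y`. -/
def proj (S : Set E) (x : E) : E :=
  Classical.epsilon (IsProj S x)

/-- `IsResolvent A x y` : `y ∈ (Id + A)⁻¹ x`, that is, `x ∈ y + A y`. -/
def IsResolvent (A : E → Set E) (x y : E) : Prop :=
  x - y ∈ A y

/-- The resolvent `J_A = (Id + A)⁻¹`. For `A` maximally monotone in a Hilbert space, it is the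
unique `y` with `IsResolvent A x y`. -/
def opResolvent (A : E → Set E) (x : E) : E :=
  Classical.epsilon (IsResolvent A x)

end ConvexAnalysis

/-! ### The spaces -/

/-- The Hilbert space `H × ℝ^N`. -/
abbrev Blk (H : Type*) (N : ℕ) : Type _ :=
  WithLp 2 (H × EuclideanSpace ℝ (Fin N))

/-- The Hilbert space `(H × ℝ^N)^(N+1)`; the blocks `1, …, N + 1` are indexed by
`0, …, N : Fin (N + 1)`. -/
abbrev ProdSp (H : Type*) (N : ℕ) : Type _ :=
  PiLp 2 (fun _ : Fin (N + 1) => Blk H N)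

section Operators

variable {H : Type*} [NormedAddCommGroup H] [InnerProductSpace ℝ H] {N : ℕ}

/-- `P₁ = {p ∈ ℝ^N : ∑ i, p i = 1}`. -/
def sumOne (N : ℕ) : Set (EuclideanSpace ℝ (Fin N)) :=
  {p | ∑ i, p i = 1}

/-- `B_i(x, p) = (p_i ∂f_i(x)) × (N_{[0,+∞[}(p_i) e_i - f_i(x) e_i)`. -/
def opB (f : Fin N → H → ℝ) (i : Fin N) (w : Blk H N) : Set (Blk H N) :=
  {v | v.fst ∈ w.snd i • subdiff (f i) w.fst ∧
    ∃ t ∈ normalCone (Set.Ici (0 : ℝ)) (w.snd i),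
      v.snd = t • EuclideanSpace.single i (1 : ℝ) -
        f i w.fst • EuclideanSpace.single i (1 : ℝ)}

/-- `A₁(x, p) = N_Q(x) × N_{P₁}(p)`. -/
def opA (Q : Set H) (w : Blk H N) : Set (Blk H N) :=
  {v | v.fst ∈ normalCone Q w.fst ∧ v.snd ∈ normalCone (sumOne N) w.snd}

/-- `C(x, p) = (∇h(x), 0)`. -/
def opC [CompleteSpace H] (h : H → ℝ) (w : Blk H N) : Blk H N :=
  WithLp.toLp 2 (gradient h w.fst, 0)

/-- `w = (x, p)` solves `0 ∈ A₁(x, p) + ∑ i, B_i(x, p) + C(x, p)`. -/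
def SolvesSum [CompleteSpace H] (Q : Set H) (f : Fin N → H → ℝ) (h : H → ℝ)
    (w : Blk H N) : Prop :=
  (0 : Blk H N) ∈ opA Q w + (∑ i, opB f i w) + {opC h w}

/-- `Ã₁ = B_1 × ⋯ × B_N × A₁`. -/
def opATilde (Q : Set H) (f : Fin N → H → ℝ) (z : ProdSp H N) : Set (ProdSp H N) :=
  {v | (∀ i : Fin N, v i.castSucc ∈ opB f i (z i.castSucc)) ∧
    v (Fin.last N) ∈ opA Q (z (Fin.last N))}

/-- `C̃₁(z) = (C(z_1), 0, …, 0)`. -/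
def opCTilde [CompleteSpace H] (h : H → ℝ) (z : ProdSp H N) : ProdSp H N :=
  WithLp.toLp 2 fun i => if i = 0 then opC h (z 0) else 0

/-- The diagonal `V₁ = {z : z_1 = ⋯ = z_(N+1)}`. -/
def diag (H : Type*) [NormedAddCommGroup H] [InnerProductSpace ℝ H] (N : ℕ) :
    Submodule ℝ (ProdSp H N) where
  carrier := {z | ∀ i j, z i = z j}
  zero_mem' := fun _ _ => rfl
  add_mem' := fun {a b} ha hb i j => by simp [ha i j, hb i j]
  smul_mem' := fun c {a} ha i j => by simp [ha i j]

/-- `z` solves `0 ∈ Ã₁(z) + C̃₁(z) + N_{V₁}(z)`. -/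
def SolvesProd [CompleteSpace H] (Q : Set H) (f : Fin N → H → ℝ) (h : H → ℝ)
    (z : ProdSp H N) : Prop :=
  (0 : ProdSp H N) ∈
    opATilde Q f z + {opCTilde h z} + normalCone (diag H N : Set (ProdSp H N)) z

/-- The forward–backward routine with step size `γ`: `z k = ((x_i^k, p_i^k))_i`,
`zbar k` are the auxiliary variables `((x̄_i^k, p̄_i^k))_i`, and `zt k` are the intermediate
points `((x̃_i^k, p̃_i^k))_i`. -/
structure FBRoutine [CompleteSpace H] (Q : Set H) (f : Fin N → H → ℝ) (h : H → ℝ) (γ : ℝ)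
    (z zbar zt : ℕ → ProdSp H N) : Prop where
  init : z 0 ∈ diag H N
  init_bar : zbar 0 ∈ (diag H N)ᗮ
  resolvent_step : ∀ k, ∀ i : Fin N,
    zt k i.castSucc = opResolvent (fun w => γ • opB f i w)
      (WithLp.toLp 2
        ((z k i.castSucc).fst + γ • (zbar k i.castSucc).fst
            - (γ / ((N : ℝ) + 1)) • gradient h (z k 0).fst,
          (z k i.castSucc).snd + γ • (zbar k i.castSucc).snd))
  proj_step : ∀ k,
    zt k (Fin.last N) = WithLp.toLp 2
      (proj Q ((z k (Fin.last N)).fst + γ • (zbar k (Fin.last N)).fst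
            - (γ / ((N : ℝ) + 1)) • gradient h (z k 0).fst),
        proj (sumOne N) ((z k (Fin.last N)).snd + γ • (zbar k (Fin.last N)).snd))
  average_step : ∀ k, ∀ i : Fin (N + 1),
    z (k + 1) i = (1 / ((N : ℝ) + 1)) • ∑ j, zt k j
  bar_step : ∀ k, ∀ i : Fin (N + 1),
    zbar (k + 1) i = zbar k i + (1 / γ) • (z (k + 1) i - zt k i)

end Operators

end FBSub

end

/-! The routine is a forward–backward method combined with Spingarn's partial inverse with respect
to the diagonal V. The product operator Ã₁ is monotone, and the resolvents of γÃ₁ act blockwise. On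
V, the operator C̃₁ may be replaced by its projection D onto V, since the difference lies in V⊥ and
is absorbed by the normal cone. A diagonal point x solves the problem exactly when some s in V⊥
satisfies s - D x ∈ Ã₁ x.

Put w_k = z^k + γ z̄^k. Baillon–Haddad makes D cocoercive. Together with monotonicity and the
orthogonality of V and V⊥, this shows that ‖w_k - (x + γ s)‖² decreases for every such pair, by at
least a multiple of ‖D z^k - D x‖² + ‖w_k - w_{k+1}‖²; here γ < 2β is used. Both residuals therefore
vanish. Minty's argument then identifies weak cluster points as solution pairs, Opial's lemma gives
weak convergence of w_k, and projecting onto V gives that of z^k.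

The resolvent of γB_i is single-valued because B_i is the monotone operator of the saddle function
p_i f_i(x) on p_i ≥ 0. It is everywhere defined because its equation is solved by projecting onto an
epigraph (`exists_prox_posPart`). -/

namespace FBSub

open Filter Topology

/-! ### Weak limits along ultrafilters and Opial's lemma. -/

section WeakConvergence

variable {E : Type*} [NormedAddCommGroup E] [InnerProductSpace ℝ E]

/-- A sequence bounded in norm has a weak limit along every ultrafilter. -/
lemma exists_weak_limit_ultrafilter [CompleteSpace E] {ι : Type*} (U : Ultrafilter ι) {w : ι → E}
    {R : ℝ} (hR : ∀ k, ‖w k‖ ≤ R) :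
    ∃ p : E, ∀ v, Tendsto (fun k => inner ℝ (w k) v) U (𝓝 (inner ℝ p v)) := by
  have hb : ∀ v k, |inner ℝ (w k) v| ≤ R * ‖v‖ := fun v k =>
    (abs_real_inner_le_norm _ _).trans (mul_le_mul_of_nonneg_right (hR k) (norm_nonneg _))
  have hlim : ∀ v, ∃ a : ℝ, Tendsto (fun k => inner ℝ (w k) v) U (𝓝 a) := by
    intro v
    have hc : IsCompact (Set.Icc (-(R * ‖v‖)) (R * ‖v‖)) := isCompact_Icc
    obtain ⟨a, -, ha⟩ := hc.ultrafilter_le_nhds (U.map fun k => inner ℝ (w k) v) (by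
      rw [le_principal_iff]
      exact Ultrafilter.mem_map.2 (Filter.univ_mem' fun k => abs_le.1 (hb v k)))
    exact ⟨a, ha⟩
  choose φ hφ using hlim
  -- The pointwise limits form a linear functional bounded by `R`; Riesz representation turns it
  -- into a vector.
  let L : E →ₗ[ℝ] ℝ :=
    { toFun := φ
      map_add' := fun u v => tendsto_nhds_unique (hφ (u + v)) (by
        simpa only [inner_add_right] using (hφ u).add (hφ v))
      map_smul' := fun c v => tendsto_nhds_unique (hφ (c • v)) (by
        simpa only [inner_smul_right, smul_eq_mul, RingHom.id_apply] using (hφ v).const_mul c) }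
  let Lc : E →L[ℝ] ℝ := L.mkContinuous R fun v =>
    le_of_tendsto (hφ v).abs (Filter.univ_mem' fun k => hb v k)
  refine ⟨(InnerProductSpace.toDual ℝ E).symm Lc, fun v => ?_⟩
  rw [InnerProductSpace.toDual_symm_apply]
  exact hφ v

/-- **Opial's lemma**, with weak cluster points taken along ultrafilters. -/
lemma opial [CompleteSpace E] {w : ℕ → E} {F : Set E} (hne : F.Nonempty)
    (hconv : ∀ p ∈ F, ∃ l, Tendsto (fun k => ‖w k - p‖ ^ 2) atTop (𝓝 l))
    (hcl : ∀ U : Ultrafilter ℕ, (U : Filter ℕ) ≤ atTop → ∀ p,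
      (∀ v, Tendsto (fun k => inner ℝ (w k) v) U (𝓝 (inner ℝ p v))) → p ∈ F) :
    ∃ p ∈ F, ∀ v, Tendsto (fun k => inner ℝ (w k) v) atTop (𝓝 (inner ℝ p v)) := by
  obtain ⟨R, hR⟩ : ∃ R, ∀ k, ‖w k‖ ≤ R := by
    obtain ⟨q, hq⟩ := hne
    obtain ⟨l, hl⟩ := hconv q hq
    obtain ⟨M, hM⟩ := hl.bddAbove_range
    refine ⟨(1 + M) + ‖q‖, fun k => ?_⟩
    have h1 : ‖w k - q‖ ^ 2 ≤ M := hM ⟨k, rfl⟩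
    have h2 : ‖w k‖ ≤ ‖w k - q‖ + ‖q‖ := by simpa using norm_add_le (w k - q) q
    nlinarith [sq_nonneg (‖w k - q‖ - 1)]
  have hlim : ∀ U : Ultrafilter ℕ, ∃ p, ∀ v,
      Tendsto (fun k => inner ℝ (w k) v) U (𝓝 (inner ℝ p v)) := fun U =>
    exists_weak_limit_ultrafilter U hR
  obtain ⟨p, hp⟩ := hlim (Ultrafilter.of atTop)
  have hpF := hcl _ (Ultrafilter.of_le _) p hp
  refine ⟨p, hpF, fun v => ?_⟩
  rw [tendsto_iff_ultrafilter]
  intro U hU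
  obtain ⟨q, hq⟩ := hlim U
  have hqF := hcl U hU q hq
  suffices p = q by subst this; exact hq v
  obtain ⟨a, ha⟩ := hconv p hpF
  obtain ⟨b, hb⟩ := hconv q hqF
  -- Polarization expresses this pairing through the two convergent distances, so it has one limit
  -- along the whole sequence, and `p` and `q` pair equally with `p - q`.
  have hd : ∀ k, inner ℝ (w k) (p - q)
      = (‖w k - q‖ ^ 2 - ‖w k - p‖ ^ 2 + ‖p‖ ^ 2 - ‖q‖ ^ 2) / 2 := by
    intro k
    rw [norm_sub_sq_real, norm_sub_sq_real, inner_sub_right]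
    ring
  have hl : Tendsto (fun k => inner ℝ (w k) (p - q)) atTop
      (𝓝 ((b - a + ‖p‖ ^ 2 - ‖q‖ ^ 2) / 2)) := by
    simp only [hd]
    exact (((hb.sub ha).add_const _).sub_const _).div_const _
  have e1 := tendsto_nhds_unique (hp (p - q)) (hl.mono_left (Ultrafilter.of_le _))
  have e2 := tendsto_nhds_unique (hq (p - q)) (hl.mono_left hU)
  have : inner ℝ (p - q) (p - q) = (0 : ℝ) := by rw [inner_sub_left, e1, e2, sub_self]
  exact sub_eq_zero.1 (inner_self_eq_zero.1 this)

/-- The pairing of a weakly convergent bounded family with a strongly convergent one converges. -/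
lemma tendsto_inner_of_weak_of_strong {ι : Type*} {l : Filter ι} {a b : ι → E} {p q : E} {R : ℝ}
    (hR : ∀ k, ‖a k‖ ≤ R) (ha : ∀ v, Tendsto (fun k => inner ℝ (a k) v) l (𝓝 (inner ℝ p v)))
    (hb : Tendsto b l (𝓝 q)) :
    Tendsto (fun k => inner ℝ (a k) (b k)) l (𝓝 (inner ℝ p q)) := by
  have h0 : Tendsto (fun k => inner ℝ (a k) (b k - q)) l (𝓝 0) := by
    have hn : Tendsto (fun k => R * ‖b k - q‖) l (𝓝 0) := by
      simpa using ((hb.sub_const q).norm).const_mul R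
    refine squeeze_zero_norm (fun k => ?_) hn
    exact (abs_real_inner_le_norm _ _).trans (mul_le_mul_of_nonneg_right (hR k) (norm_nonneg _))
  have := h0.add (ha q)
  simpa [inner_sub_right] using this

/-- In a Hilbert space, convergence of all inner products is weak convergence. -/
lemma tendsto_toWeakSpace_of_inner [CompleteSpace E] {ι : Type*} {l : Filter ι} {w : ι → E} {p : E}
    (hw : ∀ v, Tendsto (fun k => inner ℝ (w k) v) l (𝓝 (inner ℝ p v))) :
    Tendsto (fun k => toWeakSpace ℝ E (w k)) l (𝓝 (toWeakSpace ℝ E p)) := by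
  refine (WeakBilin.tendsto_iff_forall_eval_tendsto (topDualPairing ℝ E).flip ?_).2 ?_
  rotate_left
  · intro L
    obtain ⟨v, rfl⟩ := (InnerProductSpace.toDual ℝ E).surjective L
    have := hw v
    simp_rw [real_inner_comm v] at this
    exact this
  · intro x y hxy
    refine ext_inner_left ℝ fun v => ?_
    exact LinearMap.congr_fun hxy (InnerProductSpace.toDual ℝ E v)

end WeakConvergence

/-! ### Forward–backward iteration with partial inverses. -/

section ForwardBackward

variable {E : Type*} [NormedAddCommGroup E] [InnerProductSpace ℝ E]

/-- Monotonicity of a set-valued operator. -/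
def IsMonotone (A : E → Set E) : Prop :=
  ∀ x y, ∀ u ∈ A x, ∀ v ∈ A y, 0 ≤ inner ℝ (u - v) (x - y)

/-- Minty's argument: testing against the resolvent `y` of `u + x` gives -‖x - y‖² ≥ 0, hence `y =
x`. Surjectivity of Id + A thus serves as maximality. -/
lemma mem_of_forall_inner_nonneg {A : E → Set E}
    (hsurj : ∀ x, ∃ y, IsResolvent A x y) {x u : E}
    (h : ∀ y, ∀ v ∈ A y, 0 ≤ inner ℝ (u - v) (x - y)) : u ∈ A x := by
  obtain ⟨y, hy⟩ := hsurj (u + x)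
  have h1 := h y _ hy
  have h2 : u - (u + x - y) = -(x - y) := by abel
  rw [h2, inner_neg_left, real_inner_self_eq_norm_sq] at h1
  have h3 : x - y = 0 := by
    rw [← norm_eq_zero]; nlinarith [norm_nonneg (x - y)]
  obtain rfl := sub_eq_zero.1 h3
  simpa [IsResolvent] using hy

lemma IsMonotone.resolvent_unique {A : E → Set E} (hA : IsMonotone A) {x y z : E}
    (hy : IsResolvent A x y) (hz : IsResolvent A x z) : y = z := by
  have h := hA y z _ hy _ hz
  have h2 : x - y - (x - z) = -(y - z) := by abel
  rw [h2, inner_neg_left, real_inner_self_eq_norm_sq] at h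
  exact sub_eq_zero.1 (norm_eq_zero.1 (by nlinarith [norm_nonneg (y - z)]))

/-- A sequence of reals that decreases at least by nonnegative amounts `d k` converges, and
`d k → 0`. -/
lemma tendsto_of_add_le {a d : ℕ → ℝ} (ha : ∀ k, 0 ≤ a k) (hd : ∀ k, 0 ≤ d k)
    (h : ∀ k, a (k + 1) + d k ≤ a k) :
    (∃ l, Tendsto a atTop (𝓝 l)) ∧ Tendsto d atTop (𝓝 0) := by
  have hanti : Antitone a := antitone_nat_of_succ_le fun k => by linarith [h k, hd k]
  have hl := tendsto_atTop_ciInf hanti ⟨0, by rintro _ ⟨k, rfl⟩; exact ha k⟩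
  refine ⟨⟨_, hl⟩, squeeze_zero hd (fun k => by linarith [h k] : ∀ k, d k ≤ a k - a (k + 1)) ?_⟩
  simpa using hl.sub (hl.comp (tendsto_add_atTop_nat 1))

variable {V : Submodule ℝ E} {A : E → Set E} {D : E → E} {β γ : ℝ} {x s : ℕ → E}

/-- One step of the forward–backward iteration with partial inverses. -/
lemma partialInverse_step (hA : IsMonotone A) {x₀ x₁ s₀ s₁ xs ss : E}
    (hx₀ : x₀ ∈ V) (hx₁ : x₁ ∈ V) (hs₀ : s₀ ∈ Vᗮ) (hs₁ : s₁ ∈ Vᗮ) (hxs : xs ∈ V) (hss : ss ∈ Vᗮ)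
    (hD₀ : D x₀ ∈ V) (hDs : D xs ∈ V)
    (hcoco : β * ‖D x₀ - D xs‖ ^ 2 ≤ inner ℝ (D x₀ - D xs) (x₀ - xs))
    (hγ0 : 0 < γ)
    (hstep : x₀ - x₁ + γ • s₁ - γ • D x₀ ∈ A (x₁ + γ • (s₀ - s₁)))
    (hsol : γ • ss - γ • D xs ∈ A xs) :
    ‖(x₁ + γ • s₁) - (xs + γ • ss)‖ ^ 2 + (‖(x₀ + γ • s₀) - (x₁ + γ • s₁)‖ ^ 2
      + 2 * γ * (β * ‖D x₀ - D xs‖ ^ 2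
        - ‖D x₀ - D xs‖ * ‖(x₀ + γ • s₀) - (x₁ + γ • s₁)‖))
      ≤ ‖(x₀ + γ • s₀) - (xs + γ • ss)‖ ^ 2 := by
  have hm := hA _ _ _ hstep _ hsol
  set c := D x₀ - D xs with hc
  set p := x₀ - x₁ with hp
  set q := x₁ - xs with hq
  set b := s₀ - s₁ with hb
  set e := s₁ - ss with he
  have hpV : p ∈ V := V.sub_mem hx₀ hx₁
  have hqV : q ∈ V := V.sub_mem hx₁ hxs
  have hcV : c ∈ V := V.sub_mem hD₀ hDs
  have hbV : b ∈ Vᗮ := Vᗮ.sub_mem hs₀ hs₁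
  have heV : e ∈ Vᗮ := Vᗮ.sub_mem hs₁ hss
  have o1 : inner ℝ p b = (0 : ℝ) := Submodule.inner_right_of_mem_orthogonal hpV hbV
  have o2 : inner ℝ q e = (0 : ℝ) := Submodule.inner_right_of_mem_orthogonal hqV heV
  have o3 : inner ℝ c b = (0 : ℝ) := Submodule.inner_right_of_mem_orthogonal hcV hbV
  have o4 : inner ℝ p e = (0 : ℝ) := Submodule.inner_right_of_mem_orthogonal hpV heV
  have o5 : inner ℝ q b = (0 : ℝ) := Submodule.inner_right_of_mem_orthogonal hqV hbV
  have e1 : p + γ • s₁ - γ • D x₀ - (γ • ss - γ • D xs) = p + γ • e - γ • c := by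
    rw [he, hc]; module
  have e2 : x₁ + γ • b - xs = q + γ • b := by rw [hq]; abel
  have e3 : (x₁ + γ • s₁) - (xs + γ • ss) = q + γ • e := by rw [hq, he]; module
  have e4 : (x₀ + γ • s₀) - (x₁ + γ • s₁) = p + γ • b := by rw [hp, hb]; module
  have e5 : (x₀ + γ • s₀) - (xs + γ • ss) = (q + γ • e) + (p + γ • b) := by
    rw [hp, hb, hq, he]; module
  have e6 : x₀ - xs = p + q := by rw [hp, hq]; abel
  rw [e1, e2] at hm
  rw [e6, inner_add_right] at hcoco
  rw [e3, e4, e5, norm_add_sq_real (q + γ • e)]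
  -- As `c ∈ V` is orthogonal to `b`, adding `γ • b` leaves the pairing unchanged and produces the
  -- full displacement of x + γ s.
  have hcp : -(‖c‖ * ‖p + γ • b‖) ≤ -inner ℝ c p := by
    have h1 := real_inner_le_norm c (p + γ • b)
    rw [inner_add_right, inner_smul_right, o3] at h1
    linarith
  simp only [inner_add_left, inner_sub_left, inner_add_right, real_inner_smul_left,
    real_inner_smul_right, o1, o3, real_inner_comm q e, o2, real_inner_comm p e, o4, o5,
    real_inner_comm p q, real_inner_comm b e] at hm ⊢
  have o2' : inner ℝ e q = (0 : ℝ) := by rw [real_inner_comm, o2]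
  have o4' : inner ℝ e p = (0 : ℝ) := by rw [real_inner_comm, o4]
  have := mul_le_mul_of_nonneg_left hcoco hγ0.le
  have := mul_le_mul_of_nonneg_left hcp hγ0.le
  linarith [real_inner_comm p q, real_inner_comm b e]

/-- The form d² - 2γcd + 2γβc² is positive definite because γ² < 2γβ, which is the step-size
condition. -/
lemma exists_pos_mul_add_le (hγ0 : 0 < γ) (hγ : γ < 2 * β) :
    ∃ δ > 0, ∀ c d : ℝ, δ * (c ^ 2 + d ^ 2) ≤ d ^ 2 + 2 * γ * (β * c ^ 2 - c * d) := by
  have hβ : 0 < β := by linarith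
  -- the quadratic form is `(1 - θ) d² + (2γβ - γ²/θ) c² + (√θ d - γ c/√θ)²`
  obtain ⟨θ, hθ1, hθ2⟩ : ∃ θ, γ / (2 * β) < θ ∧ θ < 1 :=
    exists_between ((div_lt_one (by positivity)).2 hγ)
  have hθ0 : 0 < θ := lt_trans (by positivity) hθ1
  have h1 : γ < θ * (2 * β) := (div_lt_iff₀ (by positivity)).1 hθ1
  have h2 : 0 < 2 * γ * β - γ ^ 2 / θ := by
    rw [sub_pos, div_lt_iff₀ hθ0]; nlinarith
  refine ⟨min (1 - θ) (2 * γ * β - γ ^ 2 / θ), lt_min (by linarith) h2, fun c d => ?_⟩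
  have h3 : 0 ≤ (θ * d - γ * c) ^ 2 / θ := by positivity
  have h4 : (θ * d - γ * c) ^ 2 / θ = θ * d ^ 2 - 2 * γ * c * d + γ ^ 2 / θ * c ^ 2 := by
    field_simp; ring
  have h5 := mul_le_mul_of_nonneg_right (min_le_left (1 - θ) (2 * γ * β - γ ^ 2 / θ)) (sq_nonneg d)
  have h6 := mul_le_mul_of_nonneg_right (min_le_right (1 - θ) (2 * γ * β - γ ^ 2 / θ)) (sq_nonneg c)
  nlinarith

/-- Weak convergence of the forward–backward iteration with partial inverses. -/
theorem partialInverse_forwardBackward [CompleteSpace E] [V.HasOrthogonalProjection]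
    (hA : IsMonotone A) (hsurj : ∀ u, ∃ y, IsResolvent A u y) (hγ0 : 0 < γ) (hγ : γ < 2 * β)
    (hD : ∀ y ∈ V, D y ∈ V)
    (hcoco : ∀ y ∈ V, ∀ y' ∈ V, β * ‖D y - D y'‖ ^ 2 ≤ inner ℝ (D y - D y') (y - y'))
    (hx : ∀ k, x k ∈ V) (hs : ∀ k, s k ∈ Vᗮ)
    (hstep : ∀ k, x k - x (k + 1) + γ • s (k + 1) - γ • D (x k)
      ∈ A (x (k + 1) + γ • (s k - s (k + 1))))
    (hsol : ∃ xs ∈ V, ∃ ss ∈ Vᗮ, γ • ss - γ • D xs ∈ A xs) :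
    ∃ xs ∈ V, ∃ ss ∈ Vᗮ, γ • ss - γ • D xs ∈ A xs ∧
      ∀ v, Tendsto (fun k => inner ℝ (x k) v) atTop (𝓝 (inner ℝ xs v)) := by
  have hβ : 0 < β := by linarith
  set w : ℕ → E := fun k => x k + γ • s k with hw
  obtain ⟨δ, hδ, hquad⟩ := exists_pos_mul_add_le hγ0 hγ
  have fejer : ∀ xs ∈ V, ∀ ss ∈ Vᗮ, γ • ss - γ • D xs ∈ A xs →
      (∃ l, Tendsto (fun k => ‖w k - (xs + γ • ss)‖ ^ 2) atTop (𝓝 l)) ∧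
      Tendsto (fun k => δ * (‖D (x k) - D xs‖ ^ 2 + ‖w k - w (k + 1)‖ ^ 2)) atTop (𝓝 0) := by
    intro xs hxs ss hss hsol
    refine tendsto_of_add_le (fun k => by positivity) (fun k => by positivity) fun k => ?_
    refine le_trans (add_le_add le_rfl (hquad _ _)) ?_
    exact partialInverse_step hA (hx k) (hx (k + 1)) (hs k) (hs (k + 1)) hxs hss (hD _ (hx k))
      (hD _ hxs) (hcoco _ (hx k) _ hxs) hγ0 (hstep k) hsol
  obtain ⟨x₀, hx₀, s₀, hs₀, hsol₀⟩ := hsol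
  have hsq : ∀ {a b : ℕ → ℝ} (_ : ∀ k, 0 ≤ a k) (_ : ∀ k, δ * a k ^ 2 ≤ b k)
      (_ : Tendsto b atTop (𝓝 0)), Tendsto a atTop (𝓝 0) := by
    intro a b ha hab hb
    have h1 : Tendsto (fun k => a k ^ 2) atTop (𝓝 0) :=
      squeeze_zero (fun k => by positivity)
        (fun k => by rw [le_div_iff₀ hδ, mul_comm]; exact hab k : ∀ k, a k ^ 2 ≤ b k / δ)
        (by simpa using hb.div_const δ)
    have h2 := h1.sqrt
    simpa [Real.sqrt_sq (ha _)] using h2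
  obtain ⟨⟨l₀, hl₀⟩, hzero⟩ := fejer x₀ hx₀ s₀ hs₀ hsol₀
  have hDlim : Tendsto (fun k => D (x k)) atTop (𝓝 (D x₀)) := by
    rw [tendsto_iff_norm_sub_tendsto_zero]
    exact hsq (fun k => norm_nonneg _) (fun k => by nlinarith [sq_nonneg ‖w k - w (k + 1)‖]) hzero
  have hwdiff : Tendsto (fun k => w k - w (k + 1)) atTop (𝓝 0) := by
    rw [tendsto_zero_iff_norm_tendsto_zero]
    exact hsq (fun k => norm_nonneg _) (fun k => by nlinarith [sq_nonneg ‖D (x k) - D x₀‖]) hzero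
  obtain ⟨R, hR⟩ : ∃ R, ∀ k, ‖w k‖ ≤ R := by
    obtain ⟨M, hM⟩ := hl₀.bddAbove_range
    refine ⟨(1 + M) + ‖x₀ + γ • s₀‖, fun k => ?_⟩
    have h1 : ‖w k - (x₀ + γ • s₀)‖ ^ 2 ≤ M := hM ⟨k, rfl⟩
    have h2 : ‖w k‖ ≤ ‖w k - (x₀ + γ • s₀)‖ + ‖x₀ + γ • s₀‖ := by
      simpa using norm_add_le (w k - (x₀ + γ • s₀)) (x₀ + γ • s₀)
    nlinarith [sq_nonneg (‖w k - (x₀ + γ • s₀)‖ - 1)]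
  have hPw : ∀ k, V.starProjection (w k) = x k := fun k => by
    rw [hw]
    simp only [map_add, map_smul]
    rw [Submodule.starProjection_eq_self_iff.2 (hx k),
      V.starProjection_apply_eq_zero_iff.2 (hs k)]
    simp
  have hxR : ∀ k, ‖x k‖ ≤ R := fun k => by
    rw [← hPw k]; exact (V.norm_starProjection_apply_le _).trans (hR k)
  -- Primal–dual solution pairs encoded as single points; Opial's lemma is applied to this set
  -- rather than to the primal solutions.
  set F : Set E := {p | ∃ xs ∈ V, ∃ ss ∈ Vᗮ, γ • ss - γ • D xs ∈ A xs ∧ p = xs + γ • ss} with hF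
  obtain ⟨p, ⟨xs, hxs, ss, hss, hAs, rfl⟩, hp⟩ := opial (w := w) (F := F)
    ⟨_, x₀, hx₀, s₀, hs₀, hsol₀, rfl⟩
    (by
      rintro _ ⟨xs, hxs, ss, hss, hAs, rfl⟩
      exact (fejer xs hxs ss hss hAs).1)
    (by
      intro U hU p hp
      have hwd := hwdiff.mono_left hU
      set xs := V.starProjection p with hxs_def
      have hxs : xs ∈ V := V.starProjection_apply_mem p
      have hpx : p - xs ∈ Vᗮ := V.sub_starProjection_mem_orthogonal p
      have hwx : ∀ v, Tendsto (fun k => inner ℝ (x k) v) U (𝓝 (inner ℝ xs v)) := by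
        intro v
        have := hp (V.starProjection v)
        simp_rw [← Submodule.inner_starProjection_left_eq_right, hPw] at this
        exact this
      -- Cocoercivity bounds β‖D(x k) - D xs‖² by a pairing of a weakly null sequence with a
      -- strongly convergent one, so the strong limit `D x₀` must be `D xs`.
      have hDx : D x₀ = D xs := by
        have h1 : Tendsto (fun k => inner ℝ (x k - xs) (D (x k) - D xs)) U (𝓝 0) := by
          have := tendsto_inner_of_weak_of_strong (p := (0 : E)) (R := R + ‖xs‖)
            (a := fun k => x k - xs) (l := (U : Filter ℕ))
            (fun k => (norm_sub_le _ _).trans (add_le_add (hxR k) le_rfl))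
            (fun v => by simpa [inner_sub_left] using (hwx v).sub_const (inner ℝ xs v))
            ((hDlim.mono_left hU).sub_const (D xs))
          simpa using this
        have h2 : Tendsto (fun k => β * ‖D (x k) - D xs‖ ^ 2) U (𝓝 0) :=
          squeeze_zero (fun k => by positivity) (fun k => by
            rw [real_inner_comm]; exact hcoco _ (hx k) _ hxs) h1
        have h3 := tendsto_nhds_unique h2
          ((((hDlim.mono_left hU).sub_const (D xs)).norm.pow 2).const_mul β)
        have h4 : ‖D x₀ - D xs‖ ^ 2 = 0 := by
          rcases mul_eq_zero.1 h3.symm with h | h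
          · exact absurd h hβ.ne'
          · exact h
        exact sub_eq_zero.1 (norm_eq_zero.1 (pow_eq_zero_iff two_ne_zero |>.1 h4))
      refine ⟨xs, hxs, γ⁻¹ • (p - xs), Vᗮ.smul_mem _ hpx, ?_, by
        rw [smul_inv_smul₀ hγ0.ne']; abel⟩
      rw [smul_inv_smul₀ hγ0.ne']
      refine mem_of_forall_inner_nonneg hsurj fun y v hv => ?_
      -- the intermediate points and the corresponding values of `A`
      set t : ℕ → E := fun k => x (k + 1) + γ • (s k - s (k + 1)) with ht
      set dx : ℕ → E := fun k => V.starProjection (w k - w (k + 1)) with hdx_def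
      have hdx : ∀ k, dx k = x k - x (k + 1) := fun k => by
        rw [hdx_def]; simp only [map_sub, hPw]
      have hds : ∀ k, γ • (s k - s (k + 1)) = (w k - w (k + 1)) - dx k := fun k => by
        rw [hdx, hw]; simp only []; module
      have hdxlim : Tendsto dx U (𝓝 0) := by
        have := (V.starProjection.continuous.tendsto 0).comp hwd
        rwa [map_zero] at this
      have hdslim : Tendsto (fun k => γ • (s k - s (k + 1))) U (𝓝 0) := by
        simp_rw [hds]
        simpa using hwd.sub hdxlim
      have hmono : ∀ k, 0 ≤ inner ℝ (dx k + γ • s (k + 1) - γ • D (x k) - v) (t k - y) :=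
        fun k => by rw [hdx]; exact hA _ _ _ (hstep k) _ hv
      have hsk : ∀ k, γ • s (k + 1) = (w k - x k) - γ • (s k - s (k + 1)) := fun k => by
        rw [hw]; simp only []; module
      have hxk : ∀ k, t k = x k - dx k + γ • (s k - s (k + 1)) := fun k => by
        rw [hdx, ht]; simp only []; module
      -- split off strongly convergent parts
      have hsplit : ∀ k, inner ℝ (dx k + γ • s (k + 1) - γ • D (x k) - v) (t k - y)
          = inner ℝ (x k) (dx k - γ • (s k - s (k + 1)) - γ • D (x k) - v)
            + inner ℝ (w k - x k) (-dx k + γ • (s k - s (k + 1)) - y)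
            + inner ℝ (dx k - γ • (s k - s (k + 1)) - γ • D (x k) - v)
              (-dx k + γ • (s k - s (k + 1)) - y) := by
        intro k
        -- This is the only product of two merely weakly convergent sequences; it vanishes because
        -- they lie in V⊥ and V.
        have o : inner ℝ (w k - x k) (x k) = (0 : ℝ) := by
          have : w k - x k ∈ Vᗮ := by
            rw [hw]; simp only [add_sub_cancel_left]; exact Vᗮ.smul_mem _ (hs k)
          exact Submodule.inner_left_of_mem_orthogonal (hx k) this
        set b := γ • (s k - s (k + 1)) with hb
        have a1 : dx k + γ • s (k + 1) - γ • D (x k) - v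
            = (w k - x k) + (dx k - b - γ • D (x k) - v) := by rw [hsk]; abel
        have a2 : t k - y = x k + (-dx k + b - y) := by rw [hxk]; abel
        rw [a1, a2]
        rw [inner_add_left, inner_add_right, inner_add_right, o,
          real_inner_comm (x k) (dx k - b - γ • D (x k) - v)]
        ring
      have hs1 : Tendsto (fun k => dx k - γ • (s k - s (k + 1)) - γ • D (x k) - v) U
          (𝓝 (0 - 0 - γ • D x₀ - v)) :=
        ((hdxlim.sub hdslim).sub ((hDlim.mono_left hU).const_smul γ)).sub_const v
      have hs2 : Tendsto (fun k => -dx k + γ • (s k - s (k + 1)) - y) U (𝓝 (-0 + 0 - y)) :=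
        (hdxlim.neg.add hdslim).sub_const y
      have hlim := ((tendsto_inner_of_weak_of_strong hxR hwx hs1).add
        (tendsto_inner_of_weak_of_strong (a := fun k => w k - x k) (p := p - xs) (R := R + R)
          (fun k => (norm_sub_le _ _).trans (add_le_add (hR k) (hxR k)))
          (fun v => by simpa only [inner_sub_left] using (hp v).sub (hwx v)) hs2)).add
        (hs1.inner hs2)
      simp_rw [← hsplit] at hlim
      have hge := ge_of_tendsto' hlim hmono
      have o : inner ℝ (p - xs) xs = (0 : ℝ) := Submodule.inner_left_of_mem_orthogonal hxs hpx
      rw [hDx] at hge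
      have : inner ℝ (p - xs - γ • D xs - v) (xs - y)
          = inner ℝ xs (0 - 0 - γ • D xs - v) + inner ℝ (p - xs) (-0 + 0 - y)
            + inner ℝ (0 - 0 - γ • D xs - v) (-0 + 0 - y) := by
        have a1 : p - xs - γ • D xs - v = (p - xs) + (0 - 0 - γ • D xs - v) := by abel
        have a2 : xs - y = xs + (-0 + 0 - y) := by abel
        rw [a1, a2, inner_add_left, inner_add_right, inner_add_right, o,
          real_inner_comm xs (0 - 0 - γ • D xs - v)]
        ring
      rw [this]
      exact hge)
  refine ⟨xs, hxs, ss, hss, hAs, fun v => ?_⟩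
  have h1 := hp (V.starProjection v)
  simp_rw [← Submodule.inner_starProjection_left_eq_right, hPw] at h1
  rwa [map_add, map_smul, Submodule.starProjection_eq_self_iff.2 hxs,
    V.starProjection_apply_eq_zero_iff.2 hss, smul_zero, add_zero] at h1

end ForwardBackward

/-! ### Projections, subgradients, an epigraph projection, and cocoercivity of gradients. -/

section ConvexFunctions

variable {E : Type*} [NormedAddCommGroup E] [InnerProductSpace ℝ E]

lemma exists_variational_proj [CompleteSpace E] {S : Set E} (hne : S.Nonempty) (hcl : IsClosed S)
    (hconv : Convex ℝ S) (u : E) : ∃ v ∈ S, ∀ w ∈ S, inner ℝ (u - v) (w - v) ≤ 0 := by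
  obtain ⟨v, hv, h⟩ := exists_norm_eq_iInf_of_complete_convex hne hcl.isComplete hconv u
  exact ⟨v, hv, (norm_eq_iInf_iff_real_inner_le_zero hconv hv).1 h⟩

/-- A projection satisfies the variational inequality of a normal cone. -/
lemma IsProj.sub_mem_normalCone {S : Set E} (hconv : Convex ℝ S) {u v : E} (h : IsProj S u v) :
    u - v ∈ normalCone S v := by
  refine ⟨h.1, (norm_eq_iInf_iff_real_inner_le_zero hconv h.1).1 ?_⟩
  have : Nonempty S := ⟨⟨v, h.1⟩⟩
  refine le_antisymm (le_ciInf fun w => h.2 w w.2) ?_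
  exact ciInf_le (f := fun w : S => ‖u - w‖) ⟨0, by rintro _ ⟨w, rfl⟩; exact norm_nonneg _⟩ ⟨v, h.1⟩

lemma proj_sub_mem_normalCone [CompleteSpace E] {S : Set E} (hne : S.Nonempty) (hcl : IsClosed S)
    (hconv : Convex ℝ S) (u : E) : u - proj S u ∈ normalCone S (proj S u) := by
  refine IsProj.sub_mem_normalCone hconv (Classical.epsilon_spec (p := IsProj S u) ?_)
  obtain ⟨v, hv, h⟩ := exists_norm_eq_iInf_of_complete_convex hne hcl.isComplete hconv u
  refine ⟨v, hv, fun w hw => h ▸ ?_⟩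
  exact ciInf_le (f := fun w : S => ‖u - w‖) ⟨0, by rintro _ ⟨w, rfl⟩; exact norm_nonneg _⟩ ⟨w, hw⟩

lemma normalCone_smul_mem {S : Set E} {x u : E} {c : ℝ} (hc : 0 ≤ c) (hu : u ∈ normalCone S x) :
    c • u ∈ normalCone S x :=
  ⟨hu.1, fun y hy => by
    rw [real_inner_smul_left]; exact mul_nonpos_of_nonneg_of_nonpos hc (hu.2 y hy)⟩

lemma normalCone_monotone (S : Set E) : IsMonotone (normalCone S) := by
  rintro x y u ⟨hx, hu⟩ v ⟨hy, hv⟩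
  have h1 := hu y hy
  have h2 := hv x hx
  rw [← neg_sub x y, inner_neg_right] at h1
  rw [inner_sub_left]
  linarith

lemma IsMonotone.smul {A : E → Set E} (hA : IsMonotone A) {c : ℝ} (hc : 0 ≤ c) :
    IsMonotone fun x => c • A x := by
  rintro x y _ ⟨u, hu, rfl⟩ _ ⟨v, hv, rfl⟩
  simp only []
  rw [← smul_sub, real_inner_smul_left]
  exact mul_nonneg hc (hA x y u hu v hv)

/-- A finite convex lower semicontinuous function on a Banach space is continuous. -/
lemma continuous_of_convexOn_lowerSemicontinuous [CompleteSpace E] {f : E → ℝ}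
    (hf : ConvexOn ℝ Set.univ f) (hlsc : LowerSemicontinuous f) : Continuous f := by
  -- Baire: the closed sublevel sets cover the space, so `f` is bounded above near some point, which
  -- suffices for a convex function.
  obtain ⟨n, y, hy⟩ := nonempty_interior_of_iUnion_of_closed (f := fun n : ℕ => f ⁻¹' Set.Iic (n : ℝ))
    (fun n => hlsc.isClosed_preimage n)
    (Set.eq_univ_of_forall fun x => Set.mem_iUnion.2 (exists_nat_ge (f x)))
  rw [← continuousOn_univ]
  have htfae := (hf.continuousOn_tfae isOpen_univ Set.univ_nonempty).out 1 3
  exact htfae.2 ⟨y, Set.mem_univ y, n, Filter.eventually_map.2 (mem_interior_iff_mem_nhds.1 hy)⟩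

/-- A continuous convex function is subdifferentiable everywhere. -/
lemma subdiff_nonempty [CompleteSpace E] {f : E → ℝ} (hf : ConvexOn ℝ Set.univ f)
    (hcont : Continuous f) (x : E) : (subdiff f x).Nonempty := by
  have hconv := hf.convex_strict_epigraph
  have hopen : IsOpen {p : E × ℝ | p.1 ∈ Set.univ ∧ f p.1 < p.2} := by
    simp only [Set.mem_univ, true_and]
    exact isOpen_lt (hcont.comp continuous_fst) continuous_snd
  obtain ⟨L, hL⟩ := geometric_hahn_banach_open_point (x := (x, f x)) hconv hopen (by simp)
  set l : E →L[ℝ] ℝ := L.comp (.inl ℝ E ℝ) with hl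
  set c : ℝ := L (0, 1) with hc
  have hdec : ∀ y r, L (y, r) = l y + r * c := by
    intro y r
    have : ((y, r) : E × ℝ) = (y, 0) + r • (0, 1) := by simp
    rw [this, map_add, map_smul, hl, hc]
    simp
  -- The separating hyperplane is not vertical, so it can be normalized into a subgradient.
  have hc0 : c < 0 := by
    have := hL (x, f x + 1) ⟨Set.mem_univ _, by simp⟩
    rw [hdec, hdec] at this
    linarith
  have key : ∀ y, l y + f y * c ≤ l x + f x * c := by
    intro y
    have hlim : Tendsto (fun r => l y + r * c) (𝓝[>] (f y)) (𝓝 (l y + f y * c)) :=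
      ((continuous_const.add (continuous_id.mul continuous_const)).tendsto (f y)).mono_left
        nhdsWithin_le_nhds
    refine le_of_tendsto hlim ?_
    filter_upwards [self_mem_nhdsWithin] with r hr
    have := hL (y, r) ⟨Set.mem_univ _, hr⟩
    rw [hdec, hdec] at this
    exact this.le
  refine ⟨(-c)⁻¹ • (InnerProductSpace.toDual ℝ E).symm l, fun y => ?_⟩
  rw [real_inner_smul_left, InnerProductSpace.toDual_symm_apply, map_sub]
  have h1 := key y
  have h2 : (-c)⁻¹ * (l y - l x) ≤ f y - f x := by
    rw [inv_mul_le_iff₀ (by linarith)]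
    nlinarith
  linarith

/-- The projection onto an epigraph, in the form of a proximal step for `x ↦ ½ (p + γ f x)₊²`. -/
lemma exists_prox_posPart [CompleteSpace E] {f : E → ℝ} (hf : ConvexOn ℝ Set.univ f)
    (hcont : Continuous f) {γ : ℝ} (hγ : 0 < γ) (x₀ : E) (p : ℝ) :
    ∃ x : E, ∃ r : ℝ, 0 ≤ r ∧ p + γ * f x ≤ r ∧ r * (p + γ * f x - r) = 0 ∧
      ∃ u ∈ subdiff f x, x₀ - x = (γ * r) • u := by
  let K : Set (WithLp 2 (E × ℝ)) := {q | p + γ * f q.fst ≤ q.snd}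
  have hKne : K.Nonempty := ⟨WithLp.toLp 2 (x₀, p + γ * f x₀), le_refl (p + γ * f x₀)⟩
  have hKcl : IsClosed K := isClosed_le (by fun_prop) (by fun_prop)
  have hKconv : Convex ℝ K := by
    intro a ha b hb s t hs ht hst
    have h1 := hf.2 (Set.mem_univ a.fst) (Set.mem_univ b.fst) hs ht hst
    simp only [smul_eq_mul] at h1
    have ha' : p + γ * f a.fst ≤ a.snd := ha
    have hb' : p + γ * f b.fst ≤ b.snd := hb
    change p + γ * f (s • a.fst + t • b.fst) ≤ s * a.snd + t * b.snd
    have h2 := mul_le_mul_of_nonneg_left h1 hγ.le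
    have h3 := mul_le_mul_of_nonneg_left ha' hs
    have h4 := mul_le_mul_of_nonneg_left hb' ht
    have h5 : p = s * p + t * p := by rw [← add_mul, hst, one_mul]
    linarith
  obtain ⟨v, hv, hvar⟩ := exists_variational_proj hKne hKcl hKconv (WithLp.toLp 2 (x₀, (0 : ℝ)))
  have hv' : p + γ * f v.fst ≤ v.snd := hv
  have hvar' : ∀ y r, p + γ * f y ≤ r → inner ℝ (x₀ - v.fst) (y - v.fst) ≤ v.snd * (r - v.snd) := by
    intro y r hyr
    have := hvar (WithLp.toLp 2 (y, r)) hyr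
    rw [WithLp.prod_inner_apply] at this
    simp at this
    linarith
  have hr0 : 0 ≤ v.snd := by
    have := hvar' v.fst (v.snd + 1) (by linarith)
    simpa using this
  have hcomp : v.snd * (p + γ * f v.fst - v.snd) = 0 := by
    have := hvar' v.fst _ le_rfl
    rw [sub_self, inner_zero_right] at this
    nlinarith
  refine ⟨v.fst, v.snd, hr0, hv', hcomp, ?_⟩
  -- If r = 0, the variational inequality at `x₀` forces x = `x₀`, and any subgradient serves. If r
  -- > 0, complementarity makes the constraint active, and dividing by γr yields the subgradient.
  rcases hr0.eq_or_lt with h0 | h0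
  · obtain ⟨u, hu⟩ := subdiff_nonempty hf hcont v.fst
    refine ⟨u, hu, ?_⟩
    have := hvar' x₀ _ le_rfl
    rw [← h0, zero_mul, real_inner_self_eq_norm_sq] at this
    rw [← h0, mul_zero, zero_smul]
    exact norm_eq_zero.1 (by nlinarith [norm_nonneg (x₀ - v.fst)])
  · have hpos : 0 < γ * v.snd := mul_pos hγ h0
    refine ⟨(γ * v.snd)⁻¹ • (x₀ - v.fst), fun y => ?_, by rw [smul_inv_smul₀ hpos.ne']⟩
    have hr : p + γ * f v.fst = v.snd := by
      rcases mul_eq_zero.1 hcomp with h | h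
      · exact absurd h h0.ne'
      · linarith
    have h1 := hvar' y _ le_rfl
    rw [real_inner_smul_left]
    have h2 : (γ * v.snd)⁻¹ * inner ℝ (x₀ - v.fst) (y - v.fst) ≤ f y - f v.fst := by
      rw [inv_mul_le_iff₀ hpos]
      refine h1.trans (le_of_eq ?_)
      nth_rewrite 2 [← hr]
      ring
    linarith

variable {h : E → ℝ}

lemma hasDerivAt_line [CompleteSpace E] (hdiff : Differentiable ℝ h) (x d : E) (t : ℝ) :
    HasDerivAt (fun t : ℝ => h (x + t • d)) (inner ℝ (gradient h (x + t • d)) d) t := by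
  have h1 := (hdiff (x + t • d)).hasGradientAt.hasFDerivAt
  have h2 : HasDerivAt (fun t : ℝ => x + t • d) d t := by
    simpa using ((hasDerivAt_id t).smul_const d).const_add x
  simpa only [InnerProductSpace.toDual_apply_apply, Function.comp_def] using
    h1.comp_hasDerivAt t h2

/-- First-order characterization of convexity. -/
lemma add_inner_gradient_le [CompleteSpace E] (hconv : ConvexOn ℝ Set.univ h)
    (hdiff : Differentiable ℝ h) (x y : E) : h x + inner ℝ (gradient h x) (y - x) ≤ h y := by
  have hd := hasDerivAt_line hdiff x (y - x) 0
  have hc : ConvexOn ℝ Set.univ fun t : ℝ => h (x + t • (y - x)) := by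
    have := hconv.comp_affineMap (AffineMap.lineMap x y : ℝ →ᵃ[ℝ] E)
    refine (this.subset (Set.subset_univ _) convex_univ).congr fun t _ => ?_
    simp [AffineMap.lineMap_apply, add_comm]
  have := hc.le_slope_of_hasDerivAt (Set.mem_univ 0) (Set.mem_univ 1) zero_lt_one hd
  simp [slope_def_field, -inner_gradient_left] at this
  linarith

/-- The descent lemma. -/
lemma le_add_inner_gradient_add [CompleteSpace E] {L : ℝ} (hdiff : Differentiable ℝ h)
    (hlip : ∀ x y, ‖gradient h x - gradient h y‖ ≤ L * ‖x - y‖) (x y : E) :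
    h y ≤ h x + inner ℝ (gradient h x) (y - x) + L / 2 * ‖y - x‖ ^ 2 := by
  set d := y - x with hd
  let u : ℝ → ℝ := fun t =>
    h (x + t • d) - t * inner ℝ (gradient h x) d - L / 2 * ‖d‖ ^ 2 * t ^ 2
  have hu : ∀ t, HasDerivAt u (inner ℝ (gradient h (x + t • d)) d - inner ℝ (gradient h x) d
      - L / 2 * ‖d‖ ^ 2 * (2 * t)) t := by
    intro t
    have h1 := ((hasDerivAt_line hdiff x d t).sub
      ((hasDerivAt_id t).mul_const (inner ℝ (gradient h x) d))).sub
      ((hasDerivAt_pow 2 t).const_mul (L / 2 * ‖d‖ ^ 2))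
    simpa [-inner_gradient_left] using! h1
  have hanti : AntitoneOn u (Set.Icc 0 1) := by
    refine antitoneOn_of_deriv_nonpos (convex_Icc 0 1)
      (fun t _ => (hu t).continuousAt.continuousWithinAt)
      (fun t _ => (hu t).differentiableAt.differentiableWithinAt) fun t ht => ?_
    rw [interior_Icc] at ht
    rw [(hu t).deriv, ← inner_sub_left]
    have h1 := real_inner_le_norm (gradient h (x + t • d) - gradient h x) d
    have h2 := hlip (x + t • d) x
    rw [add_sub_cancel_left, norm_smul, Real.norm_of_nonneg ht.1.le] at h2
    nlinarith [mul_le_mul_of_nonneg_right h2 (norm_nonneg d)]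
  have := hanti (Set.left_mem_Icc.2 zero_le_one) (Set.right_mem_Icc.2 zero_le_one) zero_le_one
  simp [u, hd, -inner_gradient_left] at this
  rw [hd]
  linarith

/-- **Baillon–Haddad**: a Lipschitz gradient of a convex function is cocoercive. -/
theorem gradient_cocoercive [CompleteSpace E] {β : ℝ} (hβ : 0 < β)
    (hconv : ConvexOn ℝ Set.univ h) (hdiff : Differentiable ℝ h)
    (hlip : ∀ x y, ‖gradient h x - gradient h y‖ ≤ β⁻¹ * ‖x - y‖) (x y : E) :
    β * ‖gradient h x - gradient h y‖ ^ 2 ≤ inner ℝ (gradient h x - gradient h y) (x - y) := by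
  have key : ∀ x y : E, h x + inner ℝ (gradient h x) (y - x)
      + β / 2 * ‖gradient h y - gradient h x‖ ^ 2 ≤ h y := by
    intro x y
    set g := gradient h y - gradient h x with hg
    -- The test point is a gradient step of length β from `y` for h - ⟨∇h(x), ·⟩, whose gradient at
    -- `y` is `g`. It is bounded below from `x` and above from `y`.
    have h1 := add_inner_gradient_le hconv hdiff x (y - β • g)
    have h2 := le_add_inner_gradient_add hdiff hlip y (y - β • g)
    have e1 : y - β • g - x = (y - x) - β • g := by abel
    have e2 : y - β • g - y = -(β • g) := by abel
    have e3 : inner ℝ (gradient h y) g - inner ℝ (gradient h x) g = ‖g‖ ^ 2 := by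
      rw [← inner_sub_left, ← hg, real_inner_self_eq_norm_sq]
    rw [e1, inner_sub_right, real_inner_smul_right] at h1
    rw [e2, norm_neg, inner_neg_right, real_inner_smul_right, norm_smul, Real.norm_of_nonneg hβ.le,
      mul_pow] at h2
    have e4 : β⁻¹ / 2 * (β ^ 2 * ‖g‖ ^ 2) = β / 2 * ‖g‖ ^ 2 := by field_simp
    rw [e4] at h2
    have e5 := congrArg (β * ·) e3
    simp only [mul_sub] at e5
    linarith
  have h1 := key x y
  have h2 := key y x
  rw [norm_sub_rev] at h1
  rw [← neg_sub x y, inner_neg_right] at h1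
  rw [inner_sub_left]
  linarith

end ConvexFunctions

/-! ### Monotonicity and resolvents of the block operators. -/

section SaddleOperators

variable {H : Type*} [NormedAddCommGroup H] [InnerProductSpace ℝ H] {N : ℕ}

/-- The normal cone forces both i-th coordinates to be nonnegative, so the subgradient inequalities
may be weighted by them; the function values then cancel against the -f_i e_i terms. -/
lemma opB_monotone (f : Fin N → H → ℝ) (i : Fin N) : IsMonotone (opB f i) := by
  rintro x y u ⟨⟨a, ha, hau⟩, t, ht, htu⟩ v ⟨⟨b, hb, hbv⟩, s, hs, hsv⟩
  have hau' : u.fst = x.snd i • a := hau.symm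
  have hbv' : v.fst = y.snd i • b := hbv.symm
  have hx0 : 0 ≤ x.snd i := ht.1
  have hy0 : 0 ≤ y.snd i := hs.1
  have h1 := mul_le_mul_of_nonneg_left (ha y.fst) hx0
  have h2 := mul_le_mul_of_nonneg_left (hb x.fst) hy0
  have h3 := normalCone_monotone _ _ _ t ht s hs
  have e1 : inner ℝ (t - s) (x.snd i - y.snd i) = (t - s) * (x.snd i - y.snd i) := by
    simp [mul_comm]
  rw [e1] at h3
  have e2 : u.snd - v.snd
      = ((t - f i x.fst) - (s - f i y.fst)) • EuclideanSpace.single i (1 : ℝ) := by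
    rw [htu, hsv]; module
  have e3 : inner ℝ (u.snd - v.snd) (x.snd - y.snd)
      = ((t - f i x.fst) - (s - f i y.fst)) * (x.snd i - y.snd i) := by
    rw [e2, real_inner_smul_left, EuclideanSpace.inner_single_left]
    simp
  rw [WithLp.prod_inner_apply]
  change 0 ≤ inner ℝ (u.fst - v.fst) (x.fst - y.fst) + inner ℝ (u.snd - v.snd) (x.snd - y.snd)
  rw [e3, hau', hbv', inner_sub_left, real_inner_smul_left, real_inner_smul_left]
  rw [← neg_sub x.fst y.fst, inner_neg_right] at h1
  nlinarith

lemma exists_isResolvent_opB [CompleteSpace H] {f : Fin N → H → ℝ}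
    (hf : ∀ i, ConvexOn ℝ Set.univ (f i)) (hlsc : ∀ i, LowerSemicontinuous (f i)) {γ : ℝ}
    (hγ : 0 < γ) (i : Fin N) (w : Blk H N) :
    ∃ y, IsResolvent (fun v => γ • opB f i v) w y := by
  obtain ⟨x, r, hr0, hr1, hcomp, u, hu, hxu⟩ := exists_prox_posPart (hf i)
    (continuous_of_convexOn_lowerSemicontinuous (hf i) (hlsc i)) hγ w.fst (w.snd i)
  -- Only the i-th coordinate moves, and it becomes `r`. Complementarity then places γ⁻¹(p_i + γ
  -- f_i(x) - r) in the normal cone of the half-line at `r`.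
  let y : Blk H N := WithLp.toLp 2 (x, w.snd + (r - w.snd i) • EuclideanSpace.single i (1 : ℝ))
  have hyi : y.snd i = r := by simp [y]
  refine ⟨y, ?_⟩
  rw [IsResolvent, Set.mem_smul_set_iff_inv_smul_mem₀ hγ.ne']
  refine ⟨?_, γ⁻¹ * (w.snd i + γ * f i x - r), ?_, ?_⟩
  · rw [hyi]
    refine ⟨u, hu, ?_⟩
    change r • u = γ⁻¹ • (w.fst - x)
    rw [hxu, mul_smul, inv_smul_smul₀ hγ.ne']
  · rw [hyi]
    refine ⟨hr0, fun s hs => ?_⟩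
    have hs0 : 0 ≤ s := hs
    have e : inner ℝ (γ⁻¹ * (w.snd i + γ * f i x - r)) (s - r)
        = γ⁻¹ * ((w.snd i + γ * f i x - r) * s - r * (w.snd i + γ * f i x - r)) := by
      simp only [RCLike.inner_apply, conj_trivial]; ring
    rw [e, hcomp, sub_zero]
    exact mul_nonpos_of_nonneg_of_nonpos (inv_nonneg.2 hγ.le)
      (mul_nonpos_of_nonpos_of_nonneg (by linarith) hs0)
  · change γ⁻¹ • (w.snd - (w.snd + (r - w.snd i) • EuclideanSpace.single i (1 : ℝ)))
      = _ • _ - f i x • _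
    rw [← sub_smul, sub_add_cancel_left, ← neg_smul, smul_smul]
    congr 1
    field_simp
    ring

lemma opA_monotone (Q : Set H) : IsMonotone (opA (N := N) Q) := by
  rintro x y u ⟨hu1, hu2⟩ v ⟨hv1, hv2⟩
  rw [WithLp.prod_inner_apply]
  exact add_nonneg (normalCone_monotone Q _ _ _ hu1 _ hv1)
    (normalCone_monotone (sumOne N) _ _ _ hu2 _ hv2)

lemma smul_mem_opA {Q : Set H} {w v : Blk H N} {c : ℝ} (hc : 0 ≤ c) (hv : v ∈ opA Q w) :
    c • v ∈ opA Q w :=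
  ⟨normalCone_smul_mem hc hv.1, normalCone_smul_mem hc hv.2⟩

lemma sumOne_nonempty (hN : 1 ≤ N) : (sumOne N).Nonempty :=
  ⟨EuclideanSpace.single ⟨0, hN⟩ 1, by simp [sumOne]⟩

lemma isClosed_sumOne : IsClosed (sumOne N) :=
  isClosed_eq (by fun_prop) continuous_const

lemma convex_sumOne : Convex ℝ (sumOne N) := by
  intro p hp q hq s t _ _ hst
  have hp' : ∑ i, p i = 1 := hp
  have hq' : ∑ i, q i = 1 := hq
  simp [sumOne, Finset.sum_add_distrib, ← Finset.mul_sum, hp', hq', hst]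

lemma isResolvent_opA_proj [CompleteSpace H] (hN : 1 ≤ N) {Q : Set H} (hne : Q.Nonempty)
    (hcl : IsClosed Q) (hconv : Convex ℝ Q) {γ : ℝ} (hγ : 0 < γ) (x : H)
    (p : EuclideanSpace ℝ (Fin N)) :
    IsResolvent (fun v : Blk H N => γ • opA Q v) (WithLp.toLp 2 (x, p))
      (WithLp.toLp 2 (proj Q x, proj (sumOne N) p)) := by
  rw [IsResolvent, Set.mem_smul_set_iff_inv_smul_mem₀ hγ.ne']
  exact smul_mem_opA (inv_nonneg.2 hγ.le) ⟨proj_sub_mem_normalCone hne hcl hconv x,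
    proj_sub_mem_normalCone (sumOne_nonempty hN) isClosed_sumOne convex_sumOne p⟩

lemma mem_smul_opATilde {Q : Set H} {f : Fin N → H → ℝ} {γ : ℝ} (hγ : γ ≠ 0) {z v : ProdSp H N} :
    v ∈ γ • opATilde Q f z ↔ (∀ i : Fin N, v i.castSucc ∈ γ • opB f i (z i.castSucc)) ∧
      v (Fin.last N) ∈ γ • opA Q (z (Fin.last N)) := by
  simp only [Set.mem_smul_set_iff_inv_smul_mem₀ hγ]
  rfl

lemma opATilde_monotone (Q : Set H) (f : Fin N → H → ℝ) : IsMonotone (opATilde Q f) := by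
  rintro x y u ⟨hu, hu'⟩ v ⟨hv, hv'⟩
  rw [PiLp.inner_apply, Fin.sum_univ_castSucc]
  exact add_nonneg (Finset.sum_nonneg fun i _ => opB_monotone f i _ _ _ (hu i) _ (hv i))
    (opA_monotone Q _ _ _ hu' _ hv')

lemma exists_isResolvent_opATilde [CompleteSpace H] (hN : 1 ≤ N) {Q : Set H} (hne : Q.Nonempty)
    (hcl : IsClosed Q) (hconv : Convex ℝ Q) {f : Fin N → H → ℝ}
    (hf : ∀ i, ConvexOn ℝ Set.univ (f i)) (hlsc : ∀ i, LowerSemicontinuous (f i)) {γ : ℝ}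
    (hγ : 0 < γ) (u : ProdSp H N) : ∃ y, IsResolvent (fun z => γ • opATilde Q f z) u y := by
  choose b hb using fun i : Fin N => exists_isResolvent_opB hf hlsc hγ i (u i.castSucc)
  refine ⟨WithLp.toLp 2 (Fin.snoc (α := fun _ => Blk H N) b
    (WithLp.toLp 2 (proj Q (u (Fin.last N)).fst, proj (sumOne N) (u (Fin.last N)).snd))), ?_⟩
  refine (mem_smul_opATilde hγ.ne').2 ⟨fun i => ?_, ?_⟩
  · simpa [IsResolvent] using hb i
  · simpa [IsResolvent] using! isResolvent_opA_proj hN hne hcl hconv hγ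
      (u (Fin.last N)).fst (u (Fin.last N)).snd

end SaddleOperators

/-! ### The diagonal subspace and the translation between sum, product and routine. -/

section Diagonal

variable {H : Type*} [NormedAddCommGroup H] [InnerProductSpace ℝ H] {N : ℕ}

lemma mem_diag_iff {z : ProdSp H N} : z ∈ diag H N ↔ ∀ i j, z i = z j := Iff.rfl

lemma mem_diag_orthogonal_iff {z : ProdSp H N} : z ∈ (diag H N)ᗮ ↔ ∑ i, z i = 0 := by
  rw [Submodule.mem_orthogonal]
  constructor
  · intro h
    have := h (WithLp.toLp 2 fun _ => ∑ i, z i) fun _ _ => rfl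
    rw [PiLp.inner_apply] at this
    simp only [← inner_sum] at this
    exact inner_self_eq_zero.1 this
  · intro h u hu
    rw [PiLp.inner_apply]
    simp_rw [fun i => mem_diag_iff.1 hu i 0]
    rw [← inner_sum, h, inner_zero_right]

lemma isClosed_diag : IsClosed (diag H N : Set (ProdSp H N)) := by
  have : (diag H N : Set (ProdSp H N)) = ⋂ i, ⋂ j, {z | z i = z j} := by
    ext z; simp [mem_diag_iff]
  rw [this]
  exact isClosed_iInter fun i => isClosed_iInter fun j => isClosed_eq (by fun_prop) (by fun_prop)

variable [CompleteSpace H]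

/-- The projection onto the diagonal of `C̃₁ z`. -/
noncomputable def diagC (h : H → ℝ) (z : ProdSp H N) : ProdSp H N :=
  WithLp.toLp 2 fun _ => (1 / ((N : ℝ) + 1)) • opC h (z 0)

lemma diagC_mem (h : H → ℝ) (z : ProdSp H N) : diagC h z ∈ diag H N := fun _ _ => rfl

lemma sum_diagC (h : H → ℝ) (z : ProdSp H N) : ∑ i, diagC h z i = opC h (z 0) := by
  simp only [diagC, Finset.sum_const, Finset.card_univ, Fintype.card_fin]
  rw [← Nat.cast_smul_eq_nsmul ℝ, smul_smul]
  push_cast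
  rw [mul_one_div_cancel (by positivity), one_smul]

lemma sum_opCTilde (h : H → ℝ) (z : ProdSp H N) : ∑ i, opCTilde h z i = opC h (z 0) := by
  simp [opCTilde]

/-- Averaging over N + 1 blocks divides the squared norm by N + 1 but preserves the pairing on the
diagonal. The constant is in fact (N + 1)β; the weaker β is enough for γ < 2β. -/
lemma diagC_cocoercive {h : H → ℝ} {β : ℝ} (hβ : 0 < β)
    (hcoco : ∀ x y, β * ‖gradient h x - gradient h y‖ ^ 2
      ≤ inner ℝ (gradient h x - gradient h y) (x - y))
    {z : ProdSp H N} (hz : z ∈ diag H N) {z' : ProdSp H N} (hz' : z' ∈ diag H N) :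
    β * ‖diagC h z - diagC h z'‖ ^ 2 ≤ inner ℝ (diagC h z - diagC h z') (z - z') := by
  set c := opC h (z 0) - opC h (z' 0) with hc
  have hd : ∀ i, (diagC h z - diagC h z') i = (1 / ((N : ℝ) + 1)) • c := fun i => by
    rw [hc, smul_sub]; rfl
  have hn : (0 : ℝ) < (N : ℝ) + 1 := by positivity
  have h1 : ‖diagC h z - diagC h z'‖ ^ 2 = (1 / ((N : ℝ) + 1)) * ‖c‖ ^ 2 := by
    rw [PiLp.norm_sq_eq_of_L2]
    simp only [hd, norm_smul, Finset.sum_const, Finset.card_univ, Fintype.card_fin, nsmul_eq_mul]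
    rw [Real.norm_of_nonneg (by positivity)]
    push_cast
    field_simp
  have h2 : inner ℝ (diagC h z - diagC h z') (z - z') = inner ℝ c (z 0 - z' 0) := by
    rw [PiLp.inner_apply]
    have : ∀ i, (z - z') i = z 0 - z' 0 := fun i => by
      rw [PiLp.sub_apply, mem_diag_iff.1 hz i 0, mem_diag_iff.1 hz' i 0]
    simp only [hd, this, real_inner_smul_left, Finset.sum_const, Finset.card_univ,
      Fintype.card_fin, nsmul_eq_mul]
    push_cast
    field_simp
  have hcc : c = WithLp.toLp 2 (gradient h (z 0).fst - gradient h (z' 0).fst, 0) := by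
    rw [hc, opC, opC, ← WithLp.toLp_sub, Prod.mk_sub_mk, sub_zero]
  have h3 : inner ℝ c (z 0 - z' 0)
      = inner ℝ (gradient h (z 0).fst - gradient h (z' 0).fst) ((z 0).fst - (z' 0).fst) := by
    rw [hcc, WithLp.prod_inner_apply]
    simp [-inner_gradient_left]
  have h4 : ‖c‖ ^ 2 = ‖gradient h (z 0).fst - gradient h (z' 0).fst‖ ^ 2 := by
    rw [hcc, WithLp.prod_norm_sq_eq_of_L2]
    simp
  rw [h1, h2, h3, h4]
  refine le_trans ?_ (hcoco _ _)
  refine mul_le_mul_of_nonneg_left (mul_le_of_le_one_left (by positivity) ?_) hβ.le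
  rw [div_le_one hn]
  linarith [(Nat.cast_nonneg N : (0 : ℝ) ≤ N)]

lemma exists_of_solvesSum {Q : Set H} {f : Fin N → H → ℝ} {h : H → ℝ} {w : Blk H N}
    (hw : SolvesSum Q f h w) (γ : ℝ) :
    ∃ xs ∈ diag H N, ∃ ss ∈ (diag H N)ᗮ, γ • ss - γ • diagC h xs ∈ γ • opATilde Q f xs := by
  obtain ⟨_, ⟨a, ha, b, hb, rfl⟩, _, rfl, hsum⟩ := hw
  obtain ⟨g, hg, rfl⟩ := Set.mem_fintype_sum _ _ |>.1 hb
  let xs : ProdSp H N := WithLp.toLp 2 fun _ => w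
  let v : ProdSp H N := WithLp.toLp 2 (Fin.snoc (α := fun _ => Blk H N) g a)
  have hv : v ∈ opATilde Q f xs := ⟨fun i => by simpa [v] using hg i, by simpa [v] using ha⟩
  -- The block sum of this dual vector is the given inclusion itself, so it vanishes and the vector
  -- lies in V⊥.
  refine ⟨xs, fun _ _ => rfl, v + diagC h xs, ?_, ?_⟩
  · rw [mem_diag_orthogonal_iff]
    simp only [PiLp.add_apply, Finset.sum_add_distrib, sum_diagC]
    rw [Fin.sum_univ_castSucc]
    simp only [v, Fin.snoc_castSucc, Fin.snoc_last]
    rw [add_comm _ a]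
    exact hsum
  · rw [smul_add, add_sub_cancel_right]
    exact Set.smul_mem_smul_set hv

lemma solvesProd_of_mem {Q : Set H} {f : Fin N → H → ℝ} {h : H → ℝ} {z v : ProdSp H N}
    (hz : z ∈ diag H N) (hv : v ∈ opATilde Q f z) (hsum : ∑ i, v i + opC h (z 0) = 0) :
    SolvesProd Q f h z := by
  refine Set.mem_add.2 ⟨_, Set.add_mem_add hv (Set.mem_singleton _), -(v + opCTilde h z),
    ⟨hz, fun y hy => le_of_eq ?_⟩, by abel⟩
  have hn : -(v + opCTilde h z) ∈ (diag H N)ᗮ := by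
    refine Submodule.neg_mem _ (mem_diag_orthogonal_iff.2 ?_)
    simpa only [PiLp.add_apply, Finset.sum_add_distrib, sum_opCTilde] using hsum
  exact Submodule.inner_left_of_mem_orthogonal ((diag H N).sub_mem hy hz) hn

lemma solvesSum_of_mem {Q : Set H} {f : Fin N → H → ℝ} {h : H → ℝ} {z v : ProdSp H N}
    (hz : z ∈ diag H N) (hv : v ∈ opATilde Q f z) (hsum : ∑ i, v i + opC h (z 0) = 0)
    (i : Fin (N + 1)) : SolvesSum Q f h (z i) := by
  rw [mem_diag_iff.1 hz i 0]
  refine Set.mem_add.2 ⟨v (Fin.last N) + ∑ j : Fin N, v j.castSucc, Set.add_mem_add ?_ ?_, _,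
    Set.mem_singleton _, ?_⟩
  · rw [← mem_diag_iff.1 hz (Fin.last N) 0]; exact hv.2
  · refine (Set.mem_fintype_sum _ _).2 ⟨fun j => v j.castSucc, fun {j} => ?_, rfl⟩
    rw [← mem_diag_iff.1 hz j.castSucc 0]; exact hv.1 j
  · rw [add_comm (v (Fin.last N)), ← Fin.sum_univ_castSucc]; exact hsum

section Routine

variable {Q : Set H} {f : Fin N → H → ℝ} {h : H → ℝ} {γ : ℝ} {z zbar zt : ℕ → ProdSp H N}

lemma FBRoutine.mem_diag (hR : FBRoutine Q f h γ z zbar zt) : ∀ k, z k ∈ diag H N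
  | 0 => hR.init
  | k + 1 => fun i j => by rw [hR.average_step, hR.average_step]

lemma FBRoutine.zbar_mem (hR : FBRoutine Q f h γ z zbar zt) (k : ℕ) : zbar k ∈ (diag H N)ᗮ := by
  induction k with
  | zero => exact hR.init_bar
  | succ k ih =>
    rw [mem_diag_orthogonal_iff] at ih ⊢
    simp only [hR.bar_step, Finset.sum_add_distrib, ih, zero_add, ← Finset.smul_sum,
      Finset.sum_sub_distrib, hR.average_step, Finset.sum_const, Finset.card_univ,
      Fintype.card_fin]
    rw [← Nat.cast_smul_eq_nsmul ℝ, smul_smul]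
    push_cast
    rw [one_div_mul_cancel (by positivity), one_smul, sub_self, smul_zero]

/-- Solving the dual update for the intermediate point gives `zt k` = z^{k+1} + γ(z̄^k - z̄^{k+1}).
The blockwise resolvent relations then become one inclusion in the form required by the abstract
iteration, the factor γ/(N + 1) coming from the averaged gradient. -/
lemma FBRoutine.step (hR : FBRoutine Q f h γ z zbar zt) (hN : 1 ≤ N) (hne : Q.Nonempty)
    (hcl : IsClosed Q) (hconv : Convex ℝ Q) (hf : ∀ i, ConvexOn ℝ Set.univ (f i))
    (hlsc : ∀ i, LowerSemicontinuous (f i)) (hγ : 0 < γ) (k : ℕ) :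
    z k - z (k + 1) + γ • zbar (k + 1) - γ • diagC h (z k)
      ∈ γ • opATilde Q f (z (k + 1) + γ • (zbar k - zbar (k + 1))) := by
  have hbar : zbar (k + 1) = zbar k + γ⁻¹ • (z (k + 1) - zt k) :=
    PiLp.ext fun i => by rw [hR.bar_step, one_div]; rfl
  have e1 : z (k + 1) + γ • (zbar k - zbar (k + 1)) = zt k := by
    rw [hbar, sub_add_cancel_left, smul_neg, smul_inv_smul₀ hγ.ne']; abel
  have e2 : z k - z (k + 1) + γ • zbar (k + 1) - γ • diagC h (z k)
      = z k + γ • zbar k - γ • diagC h (z k) - zt k := by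
    rw [hbar, smul_add, smul_inv_smul₀ hγ.ne']; abel
  have e3 : ∀ i, (z k + γ • zbar k - γ • diagC h (z k)) i = WithLp.toLp 2
      ((z k i).fst + γ • (zbar k i).fst - (γ / ((N : ℝ) + 1)) • gradient h (z k 0).fst,
        (z k i).snd + γ • (zbar k i).snd) := by
    intro i
    have : γ • diagC h (z k) i
        = WithLp.toLp 2 ((γ / ((N : ℝ) + 1)) • gradient h (z k 0).fst, 0) := by
      change γ • (1 / ((N : ℝ) + 1)) • opC h (z k 0) = _
      rw [smul_smul, mul_one_div, opC, ← WithLp.toLp_smul, Prod.smul_mk, smul_zero]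
    rw [PiLp.sub_apply, PiLp.smul_apply, this]
    refine (WithLp.ofLp_injective 2) (Prod.ext rfl ?_)
    exact sub_zero _
  rw [e1, e2, mem_smul_opATilde hγ.ne']
  refine ⟨fun i => ?_, ?_⟩
  · rw [PiLp.sub_apply, e3, hR.resolvent_step]
    exact Classical.epsilon_spec (exists_isResolvent_opB hf hlsc hγ i _)
  · rw [PiLp.sub_apply, e3, hR.proj_step]
    exact isResolvent_opA_proj hN hne hcl hconv hγ _ _

end Routine

end Diagonal

end FBSub

theorem mainTheorem10 {H : Type*} [NormedAddCommGroup H] [InnerProductSpace ℝ H]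
    [CompleteSpace H] (N : ℕ) (hN : 1 ≤ N)
    (Q : Set H) (hQne : Q.Nonempty) (hQclosed : IsClosed Q) (hQconv : Convex ℝ Q)
    (f : Fin N → H → ℝ) (hfconv : ∀ i, ConvexOn ℝ Set.univ (f i))
    (hflsc : ∀ i, LowerSemicontinuous (f i))
    (β : ℝ) (hβ : 0 < β)
    (h : H → ℝ) (hhconv : ConvexOn ℝ Set.univ h) (hhdiff : Differentiable ℝ h)
    (hhlip : ∀ x y, ‖gradient h x - gradient h y‖ ≤ β⁻¹ * ‖x - y‖)
    (hsol : ∃ w : FBSub.Blk H N, FBSub.SolvesSum Q f h w)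
    (γ : ℝ) (hγ : γ ∈ Set.Ioo 0 (2 * β)) :
    (∀ (i : Fin N) (w : FBSub.Blk H N),
      ∃! y, FBSub.IsResolvent (fun v => γ • FBSub.opB f i v) w y) ∧
    ∀ z zbar zt : ℕ → FBSub.ProdSp H N, FBSub.FBRoutine Q f h γ z zbar zt →
      ∃ zlim ∈ FBSub.diag H N,
        FBSub.SolvesProd Q f h zlim ∧
        (∀ i, FBSub.SolvesSum Q f h (zlim i)) ∧
        Filter.Tendsto (fun k => toWeakSpace ℝ (FBSub.ProdSp H N) (z k)) Filter.atTop
          (nhds (toWeakSpace ℝ (FBSub.ProdSp H N) zlim)) := by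
  obtain ⟨hγ0, hγ1⟩ := hγ
  refine ⟨fun i w => ?_, fun z zbar zt hR => ?_⟩
  · obtain ⟨y, hy⟩ := FBSub.exists_isResolvent_opB hfconv hflsc hγ0 i w
    exact ⟨y, hy, fun y' hy' =>
      FBSub.IsMonotone.resolvent_unique ((FBSub.opB_monotone f i).smul hγ0.le) hy' hy⟩
  · have : CompleteSpace (FBSub.diag H N) :=
      FBSub.isClosed_diag.isComplete.completeSpace_coe
    obtain ⟨w, hw⟩ := hsol
    have hcoco := FBSub.gradient_cocoercive hβ hhconv hhdiff hhlip
    obtain ⟨zs, hzs, ss, hss, hA, hlim⟩ := FBSub.partialInverse_forwardBackward (V := FBSub.diag H N)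
      (D := FBSub.diagC h) ((FBSub.opATilde_monotone Q f).smul hγ0.le)
      (FBSub.exists_isResolvent_opATilde hN hQne hQclosed hQconv hfconv hflsc hγ0) hγ0 hγ1
      (fun y _ => FBSub.diagC_mem h y)
      (fun y hy y' hy' => FBSub.diagC_cocoercive hβ hcoco hy hy') hR.mem_diag hR.zbar_mem
      (hR.step hN hQne hQclosed hQconv hfconv hflsc hγ0) (FBSub.exists_of_solvesSum hw γ)
    rw [← smul_sub, Set.smul_mem_smul_set_iff₀ hγ0.ne'] at hA
    -- Summing the blocks removes the V⊥ part and restores the full gradient term, which is the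
    -- original inclusion at the common block.
    have hsum : ∑ i, (ss - FBSub.diagC h zs) i + FBSub.opC h (zs 0) = 0 := by
      simp only [PiLp.sub_apply, Finset.sum_sub_distrib, FBSub.sum_diagC,
        FBSub.mem_diag_orthogonal_iff.1 hss, zero_sub, neg_add_cancel]
    exact ⟨zs, hzs, FBSub.solvesProd_of_mem hzs hA hsum, FBSub.solvesSum_of_mem hzs hA hsum,
      FBSub.tendsto_toWeakSpace_of_inner hlim⟩
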